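/- For $n\ge 3$ let $C_n$ denote the cycle graph on $n$ vertices, and let $G\square H$ denote the Cartesian product of graphs: its vertex set is $V(G)\times V(H)$, and $(u,u')$ is adjacent to $(v,v')$ if and only if either $u=v$ and $u'$ is adjacent to $v'$ in $H$, or $u'=v'$ and $u$ is adjacent to $v$ in $G$. The independence complex $\Delta_G$ of a finite simple graph $G$ is the simplicial complex on $V(G)$ whose faces are the independent sets of vertices of $G$. A simplicial complex $\Delta$ is called vertex decomposable if it is a simplex (possibly $\{\emptyset\}$) or, recursively, if it has a vertex $v$ such that the deletion $\{F\in\Delta : v\notin F\}$ and the link $\{F\in\Delta : v\notin F,\ F\cup\{v\}\in\Delta\}$ are both vertex decomposable and no face of the link of $v$ is a facet (maximal face) of the deletion of $v$. A simplicial complex $\Delta$ on a finite vertex set $V$ is called Cohen–Macaulay over a field $k$ if its Stanley–Reisner ring $k[x_v : v\in V]/\bigl(\prod_{v\in F}x_v : F\subseteq V,\ F\notin\Delta\bigr)$ is a Cohen–Macaulay ring. A graph $G$ is called vertex decomposable (respectively, Cohen–Macaulay over $k$) if $\Delta_G$ is. Let $n,m\ge 3$ be integers and let $k$ be any field. If $C_n\square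 C_m$ is vertex decomposable or Cohen–Macaulay over $k$, then $n=3$ or $m=3$. -/

import Mathlib

namespace PreAbstractSimplicialComplex

variable {V : Type*}

/-- The faces of a simplicial complex in the convention where the empty set is always a face
(the set `Δ.faces` of Mathlib records the nonempty faces only). -/
def IsFace (Δ : PreAbstractSimplicialComplex V) (s : Finset V) : Prop :=
  s = ∅ ∨ s ∈ Δ.faces

/-- Facets: the faces that are maximal under inclusion. -/
def IsFacet (Δ : PreAbstractSimplicialComplex V) (s : Finset V) : Prop :=
  Maximal Δ.IsFace s

/-- A simplex: the faces are exactly the subsets of one finite set (which may be empty). -/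
def IsSimplex (Δ : PreAbstractSimplicialComplex V) : Prop :=
  ∃ s : Finset V, ∀ t : Finset V, Δ.IsFace t ↔ t ⊆ s

/-- The deletion of the vertex `v`: the faces that do not contain `v`. -/
def deletion (Δ : PreAbstractSimplicialComplex V) (v : V) : PreAbstractSimplicialComplex V where
  faces := {s | s ∈ Δ.faces ∧ v ∉ s}
  isRelLowerSet_faces := by
    rintro s ⟨hs, hv⟩
    exact ⟨(Δ.isRelLowerSet_faces hs).1, fun t hts ht =>
      ⟨(Δ.isRelLowerSet_faces hs).2 hts ht, fun h => hv (hts h)⟩⟩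

/-- The link of the vertex `v`: the sets `s` not containing `v` such that `s ∪ {v}` is a face. -/
def link [DecidableEq V] (Δ : PreAbstractSimplicialComplex V) (v : V) :
    PreAbstractSimplicialComplex V where
  faces := {s | s.Nonempty ∧ v ∉ s ∧ insert v s ∈ Δ.faces}
  isRelLowerSet_faces := by
    rintro s ⟨hs, hv, hmem⟩
    exact ⟨hs, fun t hts ht => ⟨ht, fun h => hv (hts h),
      (Δ.isRelLowerSet_faces hmem).2 (Finset.insert_subset_insert v hts)
        (Finset.insert_nonempty v t)⟩⟩

/-- `v` is a shedding vertex: it is a vertex of the complex, and no face of its link is a facet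
of its deletion. -/
def IsSheddingVertex [DecidableEq V] (Δ : PreAbstractSimplicialComplex V) (v : V) : Prop :=
  Δ.IsFace {v} ∧ ∀ s : Finset V, (Δ.link v).IsFace s → ¬ (Δ.deletion v).IsFacet s

/-- (Nonpure) vertex decomposability: the complex is a simplex, or it has a shedding vertex whose
deletion and link are both vertex decomposable. -/
inductive IsVertexDecomposable [DecidableEq V] : PreAbstractSimplicialComplex V → Prop
  | of_isSimplex (Δ : PreAbstractSimplicialComplex V) (h : Δ.IsSimplex) : IsVertexDecomposable Δ
  | of_isSheddingVertex (Δ : PreAbstractSimplicialComplex V) (v : V)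
      (hv : Δ.IsSheddingVertex v) (hdel : IsVertexDecomposable (Δ.deletion v))
      (hlink : IsVertexDecomposable (Δ.link v)) : IsVertexDecomposable Δ

/-- The Stanley–Reisner ideal of a complex: it is generated by the squarefree monomials
`∏ i ∈ s, X i` of the sets `s` that are not faces. -/
noncomputable def stanleyReisnerIdeal (k : Type*) [Field k]
    (Δ : PreAbstractSimplicialComplex V) : Ideal (MvPolynomial V k) :=
  Ideal.span {f | ∃ s : Finset V, ¬ Δ.IsFace s ∧ f = ∏ i ∈ s, MvPolynomial.X i}

/-- The Stanley–Reisner ring of a complex over the field `k`. -/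
abbrev StanleyReisnerRing (k : Type*) [Field k] (Δ : PreAbstractSimplicialComplex V) : Type _ :=
  MvPolynomial V k ⧸ stanleyReisnerIdeal k Δ

end PreAbstractSimplicialComplex

/-- The depth of a local ring: the supremum of the lengths of the regular sequences contained in
the maximal ideal. -/
noncomputable def localRingDepth (R : Type*) [CommRing R] [IsLocalRing R] : ℕ∞ :=
  ⨆ (rs : List R) (_ : (∀ r ∈ rs, r ∈ IsLocalRing.maximalIdeal R) ∧
    RingTheory.Sequence.IsRegular R rs), (rs.length : ℕ∞)

/-- A Cohen–Macaulay ring: a Noetherian ring such that the localization at each maximal ideal has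
depth equal to its Krull dimension. -/
def IsCohenMacaulayRing (R : Type*) [CommRing R] : Prop :=
  IsNoetherianRing R ∧ ∀ (p : Ideal R) [p.IsMaximal],
    (localRingDepth (Localization.AtPrime p) : WithBot ℕ∞) =
      ringKrullDim (Localization.AtPrime p)

namespace SimpleGraph

variable {V : Type*}

/-- The independence complex of a graph: the faces are the independent sets of vertices. -/
def independenceComplex (G : SimpleGraph V) : AbstractSimplicialComplex V where
  faces := {s | s.Nonempty ∧ G.IsIndepSet (s : Set V)}
  isRelLowerSet_faces := by
    rintro s ⟨hs, hind⟩
    exact ⟨hs, fun t hts ht => ⟨ht, Set.Pairwise.mono (Finset.coe_subset.2 hts) hind⟩⟩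
  singleton_mem := fun v =>
    ⟨Finset.singleton_nonempty v, by
      rw [Finset.coe_singleton]; exact Set.pairwise_singleton v _⟩

/-- A graph is vertex decomposable if its independence complex is. -/
def IsVertexDecomposable [DecidableEq V] (G : SimpleGraph V) : Prop :=
  G.independenceComplex.toPreAbstractSimplicialComplex.IsVertexDecomposable

/-- A graph is Cohen–Macaulay over `k` if its independence complex is, that is, if the
Stanley–Reisner ring over `k` of the independence complex is a Cohen–Macaulay ring. -/
def IsCohenMacaulay (k : Type*) [Field k] (G : SimpleGraph V) : Prop :=
  IsCohenMacaulayRing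
    (G.independenceComplex.toPreAbstractSimplicialComplex.StanleyReisnerRing k)

end SimpleGraph

/-! Suppose n, m ≥ 4. No vertex v = (a, b) is shedding: (a+1, b+1) and (a-1, b-1) form an
independent set together with v and dominate its four neighbors, so every maximal face of the link
that contains them is a facet of the deletion (`not_isSheddingVertex`). The torus has an edge, so
its complex is not a simplex either, and vertex decomposability fails.

Cohen–Macaulayness forces purity (`card_le_card_of_isCohenMacaulayRing`): at the ideal of the
variables, the dimension is at least the size of every face, and the depth at most the size of every
facet. The complex of the torus is not pure: some maximal independent set containing (0, 0) stays
independent when (0, 0) is exchanged for its four neighbors (`not_isCohenMacaulay`). -/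

/-! ### Depth is bounded by the dimension of quotients by annihilating ideals. -/

section Depth

open scoped Pointwise

/-- If `x` lies in the maximal ideal and is regular on `M`, an ideal that kills a nonzero element
of `M` also kills a nonzero element of `M ⧸ xM`. -/
theorem IsLocalRing.exists_quotSMulTop_ne_zero_of_forall_smul_eq_zero
    {R M : Type*} [CommRing R] [IsLocalRing R] [IsNoetherianRing R] [AddCommGroup M] [Module R M]
    [Module.Finite R M] {x : R} (hx : x ∈ IsLocalRing.maximalIdeal R) (hreg : IsSMulRegular M x)
    (J : Ideal R) {m : M} (hm : m ≠ 0) (hJ : ∀ a ∈ J, a • m = 0) :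
    ∃ y : QuotSMulTop x M, y ≠ 0 ∧ ∀ a ∈ J ⊔ Ideal.span {x}, a • y = 0 := by
  let N : Submodule R M := ⨅ a ∈ J, LinearMap.ker (LinearMap.lsmul R M a)
  have hN : ∀ z, z ∈ N ↔ ∀ a ∈ J, a • z = 0 := fun z => by simp [N]
  -- If N ⊆ xM, then N = xN, since xw ∈ N forces w ∈ N by regularity of x; Nakayama gives N = 0.
  have hNle : ¬ N ≤ x • (⊤ : Submodule R M) := by
    intro hle
    have hbot : N = ⊥ := by
      refine Submodule.eq_bot_of_le_smul_of_le_jacobson_bot (Ideal.span {x}) N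
        (IsNoetherian.noetherian N) ?_ ?_
      · intro z hz
        obtain ⟨w, -, rfl⟩ := (Submodule.mem_smul_pointwise_iff_exists _ _ _).1 (hle hz)
        refine Submodule.smul_mem_smul (Ideal.mem_span_singleton_self x) ((hN w).2 fun a ha => ?_)
        apply hreg
        simpa [smul_comm x a w] using (hN _).1 hz a ha
      · rw [IsLocalRing.jacobson_eq_maximalIdeal ⊥ bot_ne_top, Ideal.span_le]
        simpa using hx
    have hmN : m ∈ N := (hN m).2 hJ
    rw [hbot] at hmN
    exact hm (by simpa using hmN)
  obtain ⟨z, hz, hzx⟩ := Set.not_subset.1 hNle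
  refine ⟨Submodule.Quotient.mk z, fun h => hzx ((Submodule.Quotient.mk_eq_zero _).1 h), ?_⟩
  have hle : J ⊔ Ideal.span {x} ≤
      LinearMap.ker (LinearMap.toSpanSingleton R (QuotSMulTop x M) (Submodule.Quotient.mk z)) := by
    refine sup_le (fun a ha => ?_) ?_
    · rw [LinearMap.mem_ker, LinearMap.toSpanSingleton_apply, ← Submodule.Quotient.mk_smul,
        (hN z).1 hz a ha, Submodule.Quotient.mk_zero]
    · rw [Ideal.span_le, Set.singleton_subset_iff, SetLike.mem_coe, LinearMap.mem_ker,
        LinearMap.toSpanSingleton_apply, ← Submodule.Quotient.mk_smul,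
        Submodule.Quotient.mk_eq_zero]
      exact Submodule.smul_mem_pointwise_smul z x ⊤ trivial
  intro a ha
  simpa using hle ha

/-- The length of a regular sequence on `M` is at most the dimension of `R ⧸ J` for each ideal `J`
that kills a nonzero element of `M`. -/
theorem RingTheory.Sequence.IsRegular.length_le_ringKrullDim_quotient
    {R : Type*} [CommRing R] [IsLocalRing R] [IsNoetherianRing R] (rs : List R) :
    ∀ {M : Type*} [AddCommGroup M] [Module R M] [Module.Finite R M],
      (∀ r ∈ rs, r ∈ IsLocalRing.maximalIdeal R) → RingTheory.Sequence.IsRegular M rs →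
      ∀ (J : Ideal R) {m : M}, m ≠ 0 → (∀ a ∈ J, a • m = 0) →
      (rs.length : WithBot ℕ∞) ≤ ringKrullDim (R ⧸ J) := by
  induction rs with
  | nil =>
    intro M _ _ _ _ _ J m hm hJ
    have : Nontrivial (R ⧸ J) := Ideal.Quotient.nontrivial_iff.2 fun h => hm <| by
      simpa using hJ 1 (h ▸ trivial)
    simpa using ringKrullDim_nonneg_of_nontrivial
  | cons r rs ih =>
    intro M _ _ _ hmem hreg J m hm hJ
    obtain ⟨hr, hrs⟩ := (RingTheory.Sequence.isRegular_cons_iff M r rs).1 hreg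
    -- Enlarging J to an associated prime P makes R/P a domain. The regular element r is not in P,
    -- so passing to P + (r) lowers the dimension by at least one.
    obtain ⟨P, hP, hle⟩ := exists_le_isAssociatedPrime_of_isNoetherianRing R m hm
    obtain ⟨hprime, x, hx⟩ := isAssociatedPrime_iff.1 hP
    have hPx : ∀ a, a ∈ P ↔ a • x = 0 := fun a => by
      rw [hx, Submodule.mem_colon_singleton, Submodule.mem_bot]
    have hx0 : x ≠ 0 := fun h => hprime.ne_top <| (Ideal.eq_top_iff_one P).2 <| by
      rw [hPx, h, smul_zero]
    have hJP : J ≤ P := fun a ha => hle <| by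
      rw [Submodule.mem_colon_singleton, Submodule.mem_bot]; exact hJ a ha
    have hrP : r ∉ P := fun h => hx0 <| hr <| by
      simpa using (hPx r).1 h
    obtain ⟨y, hy, hyP⟩ := IsLocalRing.exists_quotSMulTop_ne_zero_of_forall_smul_eq_zero
      (hmem r (by simp)) hr P hx0 fun a ha => (hPx a).1 ha
    have h1 := ih (fun s hs => hmem s (by simp [hs])) hrs _ hy hyP
    have h2 : ringKrullDim ((R ⧸ P) ⧸ Ideal.span {Ideal.Quotient.mk P r}) + 1 ≤
        ringKrullDim (R ⧸ P) := by
      refine ringKrullDim_quotient_succ_le_of_nonZeroDivisor (mem_nonZeroDivisors_of_ne_zero ?_)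
      rwa [Ne, Ideal.Quotient.eq_zero_iff_mem]
    have h3 : ringKrullDim ((R ⧸ P) ⧸ Ideal.span {Ideal.Quotient.mk P r}) =
        ringKrullDim (R ⧸ P ⊔ Ideal.span {r}) := by
      have e := DoubleQuot.quotQuotEquivQuotSup P (Ideal.span {r})
      rw [Ideal.map_span, Set.image_singleton] at e
      exact ringKrullDim_eq_of_ringEquiv e
    have h4 : ringKrullDim (R ⧸ P) ≤ ringKrullDim (R ⧸ J) :=
      ringKrullDim_le_of_surjective _ (Ideal.Quotient.factor_surjective hJP)
    rw [h3] at h2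
    rw [List.length_cons, Nat.cast_succ]
    exact ((add_le_add_left h1 1).trans h2).trans h4

/-- The depth of a Noetherian local ring is at most the dimension of its quotient by an ideal that
kills a nonzero element. -/
theorem localRingDepth_le_ringKrullDim_quotient {R : Type*} [CommRing R] [IsLocalRing R]
    [IsNoetherianRing R] (J : Ideal R) {y : R} (hy : y ≠ 0) (hJ : ∀ a ∈ J, a * y = 0) :
    (localRingDepth R : WithBot ℕ∞) ≤ ringKrullDim (R ⧸ J) := by
  have : Nontrivial (R ⧸ J) := Ideal.Quotient.nontrivial_iff.2 fun h => hy <| by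
    simpa using hJ 1 (h ▸ trivial)
  have h0 : ringKrullDim (R ⧸ J) ≠ ⊥ :=
    ne_bot_of_le_ne_bot WithBot.zero_ne_bot ringKrullDim_nonneg_of_nontrivial
  obtain ⟨d, hd⟩ := WithBot.ne_bot_iff_exists.1 h0
  rw [← hd, WithBot.coe_le_coe]
  refine iSup₂_le fun rs hrs => ?_
  rw [← WithBot.coe_le_coe, hd]
  exact_mod_cast hrs.2.length_le_ringKrullDim_quotient rs hrs.1 J hy hJ

end Depth

/-! ### Cohen–Macaulay Stanley–Reisner rings have pure complexes. -/

namespace PreAbstractSimplicialComplex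

open MvPolynomial

variable {V : Type*} {k : Type*} [Field k]
  {Δ : PreAbstractSimplicialComplex V}

theorem IsFace.mono {s t : Finset V} (ht : Δ.IsFace t) (hst : s ⊆ t) : Δ.IsFace s := by
  rcases s.eq_empty_or_nonempty with rfl | hs
  · exact Or.inl rfl
  · rcases ht with rfl | ht
    · exact absurd hst (by simpa [Finset.subset_empty] using hs.ne_empty)
    · exact Or.inr ((Δ.isRelLowerSet_faces ht).2 hst hs)

theorem isFace_empty : Δ.IsFace ∅ := Or.inl rfl

variable [DecidableEq V]

/-- Setting the variables outside the face `s` equal to zero. -/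
noncomputable def evalFace (k : Type*) [Field k] {s : Finset V} (hs : Δ.IsFace s) :
    Δ.StanleyReisnerRing k →+* MvPolynomial s k :=
  Ideal.Quotient.lift (Δ.stanleyReisnerIdeal k)
    (aeval (R := k) fun v => if h : v ∈ s then (X ⟨v, h⟩ : MvPolynomial s k) else 0).toRingHom <| by
    change Δ.stanleyReisnerIdeal k ≤ RingHom.ker _
    refine Ideal.span_le.2 ?_
    rintro _ ⟨t, ht, rfl⟩
    obtain ⟨v, hvt, hvs⟩ := Finset.not_subset.1 fun h => ht (hs.mono h)
    simp only [AlgHom.toRingHom_eq_coe, SetLike.mem_coe, RingHom.mem_ker, map_prod]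
    exact Finset.prod_eq_zero hvt (by simp [hvs])

theorem evalFace_mk {s : Finset V} (hs : Δ.IsFace s) (f : MvPolynomial V k) :
    evalFace k hs (Ideal.Quotient.mk _ f) =
      aeval (fun v => if h : v ∈ s then (X ⟨v, h⟩ : MvPolynomial s k) else 0) f := rfl

theorem evalFace_mk_X {s : Finset V} (hs : Δ.IsFace s) (v : V) :
    evalFace k hs (Ideal.Quotient.mk _ (X v)) = if h : v ∈ s then X ⟨v, h⟩ else 0 := by
  rw [evalFace_mk, aeval_X]

theorem evalFace_comp_evalFace {s t : Finset V} (ht : Δ.IsFace t) (hst : s ⊆ t) :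
    (aeval (R := k) fun v : t =>
      if h : v.1 ∈ s then (X ⟨v.1, h⟩ : MvPolynomial s k) else 0).toRingHom.comp (evalFace k ht) =
      evalFace k (ht.mono hst) := by
  refine Ideal.Quotient.ringHom_ext (MvPolynomial.ringHom_ext (fun c => ?_) fun v => ?_)
  · simp [evalFace_mk]
  · simp only [RingHom.comp_apply, evalFace_mk_X]
    by_cases hs : v ∈ s
    · simp [hs, hst hs]
    · by_cases ht : v ∈ t <;> simp [hs, ht]

theorem ker_evalFace_le {s t : Finset V} (ht : Δ.IsFace t) (hst : s ⊆ t) :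
    RingHom.ker (evalFace k ht) ≤ RingHom.ker (evalFace k (ht.mono hst)) := by
  intro a ha
  rw [RingHom.mem_ker, ← evalFace_comp_evalFace ht hst, RingHom.comp_apply,
    (RingHom.mem_ker).1 ha, map_zero]

/-- A variable indexed by t \ s lies in the larger kernel only. -/
theorem ker_evalFace_lt {s t : Finset V} (ht : Δ.IsFace t) (hst : s ⊂ t) :
    RingHom.ker (evalFace k ht) < RingHom.ker (evalFace k (ht.mono hst.1)) := by
  refine lt_of_le_of_ne (ker_evalFace_le ht hst.1) fun h => ?_
  obtain ⟨v, hvt, hvs⟩ := Finset.exists_of_ssubset hst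
  have hv : Ideal.Quotient.mk (Δ.stanleyReisnerIdeal k) (X v) ∈
      RingHom.ker (evalFace k (ht.mono hst.1)) := by
    rw [RingHom.mem_ker, evalFace_mk_X, dif_neg hvs]
  rw [← h, RingHom.mem_ker, evalFace_mk_X, dif_pos hvt] at hv
  exact X_ne_zero _ hv

instance {s : Finset V} (hs : Δ.IsFace s) : (RingHom.ker (evalFace k hs)).IsPrime :=
  RingHom.ker_isPrime _

/-- The ideal of the Stanley–Reisner ring generated by the variables. -/
noncomputable def irrelevantIdeal (k : Type*) [Field k] (Δ : PreAbstractSimplicialComplex V) :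
    Ideal (Δ.StanleyReisnerRing k) :=
  RingHom.ker (evalFace k (isFace_empty : Δ.IsFace ∅))

instance : (irrelevantIdeal k Δ).IsMaximal := by
  have : IsEmpty (∅ : Finset V) := ⟨fun x => Finset.notMem_empty _ x.2⟩
  let e := (isEmptyAlgEquiv k (∅ : Finset V)).toRingEquiv
  have h : irrelevantIdeal k Δ =
      RingHom.ker (e.toRingHom.comp (evalFace k (isFace_empty : Δ.IsFace ∅))) := by
    ext a
    simp [irrelevantIdeal, RingHom.mem_ker]
  rw [h]
  refine RingHom.ker_isMaximal_of_surjective _ fun c => ⟨Ideal.Quotient.mk _ (C c), ?_⟩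
  change e (evalFace k _ _) = c
  rw [evalFace_mk, algHom_C]
  exact (isEmptyAlgEquiv k (∅ : Finset V)).commutes c

theorem card_le_height_irrelevantIdeal [Finite V] {t : Finset V} (ht : Δ.IsFace t) :
    (t.card : ℕ∞) ≤ (irrelevantIdeal k Δ).height := by
  -- Removing the elements of u from t one at a time gives a strictly increasing chain of primes.
  -- The second alternative lets the induction run over all finite sets u.
  have key : ∀ (u : Finset V),
      (u.card : ℕ∞) ≤ (RingHom.ker (evalFace k (ht.mono (Finset.sdiff_subset (t := u))))).height ∨
        ¬ u ⊆ t := by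
    intro u
    induction u using Finset.induction_on with
    | empty => simp
    | insert a u ha ih =>
      by_cases hau : insert a u ⊆ t
      · left
        have hat : a ∈ t := hau (Finset.mem_insert_self a u)
        have ih := ih.resolve_right (not_not.2 ((Finset.subset_insert a u).trans hau))
        have hss : t \ insert a u ⊂ t \ u := by
          refine Finset.ssubset_iff_of_subset
            (Finset.sdiff_subset_sdiff le_rfl (Finset.subset_insert a u)) |>.2 ⟨a, ?_, ?_⟩ <;>
          simp [hat, ha]
        have hlt := Ideal.height_strict_mono_of_isPrime (ker_evalFace_lt (k := k)
          (ht.mono (Finset.sdiff_subset (t := u))) hss)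
        rw [Finset.card_insert_of_notMem ha, Nat.cast_succ]
        exact (add_le_add_left ih 1).trans (Order.add_one_le_of_lt hlt)
      · exact Or.inr hau
  refine ((key t).resolve_right (not_not.2 le_rfl)).trans (Ideal.height_mono ?_)
  exact ker_evalFace_le _ (Finset.empty_subset _)

theorem card_le_ringKrullDim [Finite V] {t : Finset V} (ht : Δ.IsFace t) :
    (t.card : WithBot ℕ∞) ≤ ringKrullDim (Localization.AtPrime (irrelevantIdeal k Δ)) := by
  rw [IsLocalization.AtPrime.ringKrullDim_eq_height (irrelevantIdeal k Δ)
    (Localization.AtPrime (irrelevantIdeal k Δ))]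
  exact_mod_cast card_le_height_irrelevantIdeal ht

/-- The monomial of t is nonzero, and every variable outside t kills it because t is maximal. Modulo
those variables only the variables of t remain. -/
theorem localRingDepth_le_card [Finite V] {t : Finset V} (ht : Δ.IsFacet t) :
    (localRingDepth (Localization.AtPrime (irrelevantIdeal k Δ)) : WithBot ℕ∞) ≤ t.card := by
  let A := Localization.AtPrime (irrelevantIdeal k Δ)
  let : CommRing A := inferInstanceAs (CommRing (Localization.AtPrime (irrelevantIdeal k Δ)))
  have : IsNoetherianRing A :=
    IsLocalization.isNoetherianRing (irrelevantIdeal k Δ).primeCompl A inferInstance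
  let π : Δ.StanleyReisnerRing k →+* A := algebraMap _ A
  let mk := Ideal.Quotient.mk (Δ.stanleyReisnerIdeal k)
  let y : A := π (mk (∏ v ∈ t, X v))
  have hy : y ≠ 0 := by
    intro h
    obtain ⟨⟨s, hs⟩, hs0⟩ := (IsLocalization.map_eq_zero_iff
      (irrelevantIdeal k Δ).primeCompl A _).1 h
    have h0 := congrArg (evalFace k ht.1) hs0
    rw [map_mul, map_zero, mul_eq_zero] at h0
    rcases h0 with h0 | h0
    · exact hs (ker_evalFace_le ht.1 (Finset.empty_subset t) h0)
    · rw [map_prod, map_prod, Finset.prod_eq_zero_iff] at h0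
      obtain ⟨v, hv, hv0⟩ := h0
      rw [evalFace_mk_X, dif_pos hv] at hv0
      exact X_ne_zero _ hv0
  let J : Ideal A := Ideal.span {a | ∃ v ∉ t, a = π (mk (X v))}
  have hJ : ∀ a ∈ J, a * y = 0 := by
    intro a ha
    induction ha using Submodule.span_induction with
    | mem a ha =>
      obtain ⟨v, hv, rfl⟩ := ha
      have h0 : mk (∏ w ∈ insert v t, X w) = 0 := by
        refine Ideal.Quotient.eq_zero_iff_mem.2 <|
          Ideal.subset_span ⟨insert v t, fun h => hv ?_, rfl⟩
        exact ht.2 h (Finset.subset_insert v t) (Finset.mem_insert_self v t)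
      rw [← map_mul, ← map_mul, ← Finset.prod_insert hv, h0, map_zero]
    | zero => simp
    | add a b _ _ ha hb => rw [add_mul, ha, hb, add_zero]
    | smul c a _ ha => rw [smul_eq_mul, mul_assoc, ha, mul_zero]
  refine (localRingDepth_le_ringKrullDim_quotient J hy hJ).trans ?_
  let g : MvPolynomial V k →+* A ⧸ J := ((Ideal.Quotient.mk J).comp π).comp mk
  let ρ : MvPolynomial V k →+* MvPolynomial t k := (evalFace k ht.1).comp mk
  let h : MvPolynomial t k →+* A ⧸ J := g.comp (rename (R := k) ((↑) : t → V)).toRingHom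
  have hg : h.comp ρ = g := by
    refine MvPolynomial.ringHom_ext (fun c => ?_) fun v => ?_
    · simp [h, ρ, mk, evalFace_mk]
    · by_cases hv : v ∈ t
      · simp [h, ρ, mk, evalFace_mk_X, hv]
      · have h1 : ρ (X v) = 0 := by simp [ρ, mk, evalFace_mk_X, hv]
        rw [RingHom.comp_apply, h1, map_zero]
        have h2 : π (mk (X v)) ∈ J := Ideal.subset_span ⟨v, hv, rfl⟩
        exact (Ideal.Quotient.eq_zero_iff_mem.2 h2).symm
  -- The localization prevents a surjection from the polynomial ring onto A/J, but quotients and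
  -- localizations both induce injections of spectra. Cancelling ρ leaves a strictly monotone map
  -- from Spec(A/J) to the spectrum of the polynomial ring on t.
  have hginj : Function.Injective (PrimeSpectrum.comap g) :=
    (PrimeSpectrum.comap_injective_of_surjective mk Ideal.Quotient.mk_surjective).comp <|
      (PrimeSpectrum.localization_comap_injective A (irrelevantIdeal k Δ).primeCompl).comp <|
        PrimeSpectrum.comap_injective_of_surjective _ Ideal.Quotient.mk_surjective
  have hhinj : Function.Injective (PrimeSpectrum.comap h) := by
    refine Function.Injective.of_comp (f := PrimeSpectrum.comap ρ) ?_
    rw [← hg] at hginj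
    exact hginj
  have hmono : StrictMono (PrimeSpectrum.comap h) :=
    Monotone.strictMono_of_injective (fun _ _ hab => Ideal.comap_mono hab) hhinj
  refine (Order.krullDim_le_of_strictMono _ hmono).trans ?_
  change ringKrullDim (MvPolynomial t k) ≤ _
  rw [MvPolynomial.ringKrullDim_of_isNoetherianRing, ringKrullDim_eq_zero_of_field]
  simp

/-- The Cohen–Macaulay property of the Stanley–Reisner ring implies that no face has more elements
than a facet. -/
theorem card_le_card_of_isCohenMacaulayRing [Finite V]
    (h : IsCohenMacaulayRing (Δ.StanleyReisnerRing k)) {s t : Finset V} (hs : Δ.IsFace s)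
    (ht : Δ.IsFacet t) : s.card ≤ t.card := by
  have h1 := (card_le_ringKrullDim (k := k) hs).trans
    ((h.2 (irrelevantIdeal k Δ)).ge.trans (localRingDepth_le_card ht))
  exact_mod_cast h1

end PreAbstractSimplicialComplex

namespace SimpleGraph

/-! ### Domination criteria for general graphs. -/

section Independence

variable {V : Type*} {G : SimpleGraph V}

theorem independenceComplex_isFace {s : Finset V} :
    G.independenceComplex.toPreAbstractSimplicialComplex.IsFace s ↔
      G.IsIndepSet (s : Set V) := by
  constructor
  · rintro (rfl | hs)
    · simp [IsIndepSet]
    · exact hs.2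
  · intro hs
    rcases s.eq_empty_or_nonempty with rfl | h
    · exact Or.inl rfl
    · exact Or.inr ⟨h, hs⟩

theorem IsIndepSet.insert_of_forall_not_adj {s : Set V} (hs : G.IsIndepSet s) {v : V}
    (hv : ∀ w ∈ s, ¬ G.Adj v w) : G.IsIndepSet (insert v s) :=
  Set.pairwise_insert.2 ⟨hs, fun w hw _ => ⟨hv w hw, fun h => hv w hw h.symm⟩⟩

theorem deletion_isFace {v : V} {s : Finset V} :
    (G.independenceComplex.toPreAbstractSimplicialComplex.deletion v).IsFace s ↔
      G.IsIndepSet (s : Set V) ∧ v ∉ s := by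
  rw [← independenceComplex_isFace]
  constructor
  · rintro (rfl | hs)
    · exact ⟨Or.inl rfl, Finset.notMem_empty v⟩
    · exact ⟨Or.inr hs.1, hs.2⟩
  · rintro ⟨rfl | hs, hv⟩
    · exact Or.inl rfl
    · exact Or.inr ⟨hs, hv⟩

variable [DecidableEq V]

theorem link_isFace {v : V} {s : Finset V} :
    (G.independenceComplex.toPreAbstractSimplicialComplex.link v).IsFace s ↔
      G.IsIndepSet ((insert v s : Finset V) : Set V) ∧ v ∉ s := by
  constructor
  · rintro (rfl | hs)
    · simp [IsIndepSet]
    · exact ⟨hs.2.2.2, hs.2.1⟩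
  · rintro ⟨hs, hv⟩
    rcases s.eq_empty_or_nonempty with rfl | h
    · exact Or.inl rfl
    · exact Or.inr ⟨h, hv, Finset.insert_nonempty v s, hs⟩

/-- A vertex `v` is not a shedding vertex if an independent set of vertices not adjacent to `v`
dominates the neighbors of `v`. -/
theorem not_isSheddingVertex [Finite V] {v : V} {s : Finset V}
    (hs : G.IsIndepSet ((insert v s : Finset V) : Set V)) (hv : v ∉ s)
    (hdom : ∀ w, G.Adj v w → ∃ u ∈ s, G.Adj u w) :
    ¬ G.independenceComplex.toPreAbstractSimplicialComplex.IsSheddingVertex v := by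
  intro h
  obtain ⟨t, hst, ht⟩ := Finite.exists_le_maximal
    (p := fun t : Finset V => (G.independenceComplex.toPreAbstractSimplicialComplex.link v).IsFace t)
    (link_isFace.2 ⟨hs, hv⟩)
  have ht' := link_isFace.1 ht.1
  -- A face u ⊇ t of the deletion contains s, hence no neighbor of v; so u lies in the link, where t
  -- is maximal.
  refine h.2 t ht.1 ⟨deletion_isFace.2 ⟨ht'.1.mono (by simp), ht'.2⟩, fun u hu htu => ?_⟩
  have hu' := deletion_isFace.1 hu
  refine ht.2 (link_isFace.2 ⟨?_, hu'.2⟩) htu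
  rw [Finset.coe_insert]
  refine hu'.1.insert_of_forall_not_adj fun w hw hvw => ?_
  obtain ⟨x, hx, hxw⟩ := hdom w hvw
  exact hu'.1 (htu (hst hx)) hw hxw.ne hxw

/-- A graph with an edge but without shedding vertices is not vertex decomposable. -/
theorem not_isVertexDecomposable {a b : V} (hab : G.Adj a b)
    (h : ∀ v, ¬ G.independenceComplex.toPreAbstractSimplicialComplex.IsSheddingVertex v) :
    ¬ G.IsVertexDecomposable := by
  intro hG
  rcases hG with ⟨_, s, hs⟩ | ⟨_, v, hv, _, _⟩
  · have hmem : ∀ v, v ∈ s := fun v => by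
      simpa using (hs {v}).1 (independenceComplex_isFace.2 (by simp [IsIndepSet]))
    exact independenceComplex_isFace.1 ((hs s).2 le_rfl) (hmem a) (hmem b) hab.ne hab
  · exact h v hv

/-- If an independent set `insert v s` dominates the second neighborhood of `v` by elements of `s`,
and `v` has an independent set `w` of at least two neighbors, then the graph is not
Cohen–Macaulay. -/
theorem not_isCohenMacaulay (k : Type*) [Field k] [Finite V] {v : V} {s w : Finset V}
    (hs : G.IsIndepSet ((insert v s : Finset V) : Set V))
    (hw : G.IsIndepSet (w : Set V)) (hwv : ∀ x ∈ w, G.Adj v x) (hcard : 1 < w.card)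
    (hdom : ∀ x ∈ w, ∀ y, G.Adj x y → y ≠ v → ∃ u ∈ s, G.Adj u y) :
    ¬ G.IsCohenMacaulay k := by
  intro hG
  obtain ⟨t, hst, ht⟩ := Finite.exists_le_maximal
    (p := fun t : Finset V => G.independenceComplex.toPreAbstractSimplicialComplex.IsFace t)
    (independenceComplex_isFace.2 hs)
  have hind := independenceComplex_isFace.1 ht.1
  have hvt : v ∈ t := hst (Finset.mem_insert_self v s)
  have hnadj : ∀ x ∈ w, ∀ y ∈ t.erase v, ¬ G.Adj x y := by
    intro x hx y hy hxy
    obtain ⟨hyv, hyt⟩ := Finset.mem_erase.1 hy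
    obtain ⟨u, hu, huy⟩ := hdom x hx y hxy hyv
    exact hind (hst (Finset.mem_insert_of_mem hu)) hyt huy.ne huy
  have hdisj : Disjoint w (t.erase v) := by
    rw [Finset.disjoint_left]
    intro x hx hxt
    exact hind hvt (Finset.mem_of_mem_erase hxt) (hwv x hx).ne (hwv x hx)
  -- Exchanging v for w in the facet t gives a face with |w| - 1 > 0 more elements.
  have hface : G.IsIndepSet ((w ∪ t.erase v : Finset V) : Set V) := by
    rw [Finset.coe_union]
    refine Set.pairwise_union.2 ⟨hw, hind.mono (by simp), fun x hx y hy _ =>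
      ⟨hnadj x hx y hy, fun h => hnadj x hx y hy h.symm⟩⟩
  have hle := PreAbstractSimplicialComplex.card_le_card_of_isCohenMacaulayRing hG
    (independenceComplex_isFace.2 hface) ht
  rw [Finset.card_union_of_disjoint hdisj, Finset.card_erase_of_mem hvt] at hle
  have := Finset.card_pos.2 ⟨v, hvt⟩
  omega

end Independence

/-! ### Tori with coordinates in finite commutative rings. -/

section Torus

variable {A B : Type*} [CommRing A] [CommRing B] {G : SimpleGraph (A × B)}

/-- Reduces inequality of explicit coordinates to arithmetic with numerals, knowing only that 1, 2,
3 are nonzero. -/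
theorem ne_of_sub_eq (h1 : (1 : A) ≠ 0) (h2 : (2 : A) ≠ 0) (h3 : (3 : A) ≠ 0) {x y : A}
    (h : x - y = 1 ∨ x - y = -1 ∨ x - y = 2 ∨ x - y = -2 ∨ x - y = 3 ∨ x - y = -3) : x ≠ y := by
  rintro rfl
  simp only [sub_self, eq_comm (a := (0 : A)), neg_eq_zero] at h
  tauto

theorem add_one_ne_and_sub_one_ne (h1 : (1 : A) ≠ 0) (h2 : (2 : A) ≠ 0) (a : A) :
    a + 1 ≠ a ∧ a - 1 ≠ a ∧ a + 1 ≠ a - 1 := by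
  refine ⟨fun h => h1 ?_, fun h => h1 ?_, fun h => h2 ?_⟩
  · linear_combination h
  · linear_combination -h
  · linear_combination h

theorem not_adj_of_ne
    (hG : ∀ a b c d, G.Adj (a, b) (c, d) ↔
      (c = a + 1 ∨ c = a - 1) ∧ d = b ∨ (d = b + 1 ∨ d = b - 1) ∧ c = a)
    {x y : A × B} (h1 : y.1 ≠ x.1) (h2 : y.2 ≠ x.2) : ¬ G.Adj x y := by
  rw [show x = (x.1, x.2) from rfl, show y = (y.1, y.2) from rfl, hG]
  tauto

theorem not_adj_of_fst_ne
    (hG : ∀ a b c d, G.Adj (a, b) (c, d) ↔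
      (c = a + 1 ∨ c = a - 1) ∧ d = b ∨ (d = b + 1 ∨ d = b - 1) ∧ c = a)
    {x y : A × B} (h0 : y.1 ≠ x.1) (h1 : y.1 ≠ x.1 + 1) (h2 : y.1 ≠ x.1 - 1) : ¬ G.Adj x y := by
  rw [show x = (x.1, x.2) from rfl, show y = (y.1, y.2) from rfl, hG]
  tauto

theorem not_adj_of_snd_ne
    (hG : ∀ a b c d, G.Adj (a, b) (c, d) ↔
      (c = a + 1 ∨ c = a - 1) ∧ d = b ∨ (d = b + 1 ∨ d = b - 1) ∧ c = a)
    {x y : A × B} (h0 : y.2 ≠ x.2) (h1 : y.2 ≠ x.2 + 1) (h2 : y.2 ≠ x.2 - 1) : ¬ G.Adj x y := by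
  rw [show x = (x.1, x.2) from rfl, show y = (y.1, y.2) from rfl, hG]
  tauto

variable [DecidableEq A] [DecidableEq B] [Finite A] [Finite B]

/-- A discrete torus with both circumferences greater than two is not vertex decomposable. -/
theorem not_isVertexDecomposable_of_torus
    (hG : ∀ a b c d, G.Adj (a, b) (c, d) ↔
      (c = a + 1 ∨ c = a - 1) ∧ d = b ∨ (d = b + 1 ∨ d = b - 1) ∧ c = a)
    (hA1 : (1 : A) ≠ 0) (hA2 : (2 : A) ≠ 0) (hB1 : (1 : B) ≠ 0) (hB2 : (2 : B) ≠ 0) :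
    ¬ G.IsVertexDecomposable := by
  refine not_isVertexDecomposable (a := (0, 0)) (b := (1, 0)) ((hG _ _ _ _).2 (by simp)) ?_
  rintro ⟨a, b⟩
  refine not_isSheddingVertex (s := {(a + 1, b + 1), (a - 1, b - 1)}) ?_ ?_ ?_
  · intro x hx y hy hxy
    simp only [Finset.coe_insert, Finset.coe_singleton, Set.mem_insert_iff,
      Set.mem_singleton_iff] at hx hy
    have hA := add_one_ne_and_sub_one_ne hA1 hA2 a
    have hB := add_one_ne_and_sub_one_ne hB1 hB2 b
    refine not_adj_of_ne hG ?_ ?_ <;> rcases hx with rfl | rfl | rfl <;>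
      rcases hy with rfl | rfl | rfl <;> tauto
  · have hA := add_one_ne_and_sub_one_ne hA1 hA2 a
    simp [hA.1.symm, hA.2.1.symm]
  · rintro ⟨c, d⟩ h
    simp only [Finset.mem_insert, Finset.mem_singleton, exists_eq_or_imp, exists_eq_left, hG]
    rcases (hG _ _ _ _).1 h with ⟨rfl | rfl, rfl⟩ | ⟨rfl | rfl, rfl⟩ <;> simp

/-- A discrete torus with both circumferences greater than three is not Cohen–Macaulay. -/
theorem not_isCohenMacaulay_of_torus (k : Type*) [Field k]
    (hG : ∀ a b c d, G.Adj (a, b) (c, d) ↔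
      (c = a + 1 ∨ c = a - 1) ∧ d = b ∨ (d = b + 1 ∨ d = b - 1) ∧ c = a)
    (hA1 : (1 : A) ≠ 0) (hA2 : (2 : A) ≠ 0) (hA3 : (3 : A) ≠ 0)
    (hB1 : (1 : B) ≠ 0) (hB2 : (2 : B) ≠ 0) (hB3 : (3 : B) ≠ 0) :
    ¬ G.IsCohenMacaulay k := by
  have hA {x y : A} := ne_of_sub_eq hA1 hA2 hA3 (x := x) (y := y)
  have hB {x y : B} := ne_of_sub_eq hB1 hB2 hB3 (x := x) (y := y)
  -- The set s consists of the quarter turns of (2, 1). Since (2, 1) dominates (2, 0) and (1, 1),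
  -- its turns dominate all vertices at two steps from the origin.
  refine not_isCohenMacaulay k (v := (0, 0)) (s := {(2, 1), (-1, 2), (-2, -1), (1, -2)})
    (w := {(1, 0), (-1, 0), (0, 1), (0, -1)}) ?_ ?_ ?_ ?_ ?_
  · intro x hx y hy hxy
    simp only [Finset.coe_insert, Finset.coe_singleton, Set.mem_insert_iff,
      Set.mem_singleton_iff] at hx hy
    rcases hx with rfl | rfl | rfl | rfl | rfl <;>
      rcases hy with rfl | rfl | rfl | rfl | rfl <;>
      -- A difference of 4 may vanish. So a pair is separated either by ±1, ±2 or ±3 in both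
      -- coordinates, or by ±2 in one coordinate, where the shifts by 1 leave ±1 and ±3.
      first
      | exact absurd rfl hxy
      | (refine not_adj_of_ne hG (hA ?_) (hB ?_) <;> norm_num; done)
      | (refine not_adj_of_fst_ne hG (hA ?_) (hA ?_) (hA ?_) <;> norm_num; done)
      | (refine not_adj_of_snd_ne hG (hB ?_) (hB ?_) (hB ?_) <;> norm_num)
  · intro x hx y hy hxy
    simp only [Finset.coe_insert, Finset.coe_singleton, Set.mem_insert_iff,
      Set.mem_singleton_iff] at hx hy
    rcases hx with rfl | rfl | rfl | rfl <;> rcases hy with rfl | rfl | rfl | rfl <;>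
      first
      | exact absurd rfl hxy
      | (refine not_adj_of_ne hG (hA ?_) (hB ?_) <;> norm_num; done)
      | (refine not_adj_of_fst_ne hG (hA ?_) (hA ?_) (hA ?_) <;> norm_num; done)
      | (refine not_adj_of_snd_ne hG (hB ?_) (hB ?_) (hB ?_) <;> norm_num)
  · intro x hx
    simp only [Finset.mem_insert, Finset.mem_singleton] at hx
    rcases hx with rfl | rfl | rfl | rfl <;> rw [hG] <;> simp
  · rw [Finset.one_lt_card]
    refine ⟨(1, 0), by simp, (0, 1), by simp, fun h => hA1 (congrArg Prod.fst h)⟩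
  · rintro ⟨a, b⟩ hx ⟨c, d⟩ hxy hne
    simp only [Finset.mem_insert, Finset.mem_singleton, Prod.mk.injEq] at hx
    simp only [Finset.mem_insert, Finset.mem_singleton, exists_eq_or_imp, exists_eq_left, hG]
    rcases hx with ⟨rfl, rfl⟩ | ⟨rfl, rfl⟩ | ⟨rfl, rfl⟩ | ⟨rfl, rfl⟩ <;>
      rcases (hG _ _ _ _).1 hxy with ⟨rfl | rfl, rfl⟩ | ⟨rfl | rfl, rfl⟩ <;>
      first
      | (refine absurd ?_ hne; norm_num; done)
      | norm_num

end Torus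

/-! ### Products of cycles as tori over `Fin`. -/

section CycleGraph

theorem cycleGraph_adj_iff_eq_add_or_eq_sub {n : ℕ} {a c : Fin (n + 2)} :
    (cycleGraph (n + 2)).Adj a c ↔ c = a + 1 ∨ c = a - 1 := by
  rw [cycleGraph_adj, or_comm, sub_eq_iff_eq_add', sub_eq_iff_eq_add', eq_sub_iff_add_eq,
    add_comm c 1, eq_comm (a := a), add_comm 1 c]

open Fin.CommRing in
theorem _root_.Fin.natCast_ne_zero_of_lt {n a : ℕ} [NeZero n] (h0 : 0 < a) (h : a < n) :
    (a : Fin n) ≠ 0 := by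
  intro h'
  have := congrArg Fin.val h'
  rw [Fin.val_natCast, Nat.mod_eq_of_lt h] at this
  simp at this
  omega

open Fin.CommRing in
theorem _root_.Fin.one_two_three_ne_zero (n : ℕ) :
    (1 : Fin (n + 4)) ≠ 0 ∧ (2 : Fin (n + 4)) ≠ 0 ∧ (3 : Fin (n + 4)) ≠ 0 := by
  have h1 := Fin.natCast_ne_zero_of_lt (n := n + 4) (a := 1) (by omega) (by omega)
  have h2 := Fin.natCast_ne_zero_of_lt (n := n + 4) (a := 2) (by omega) (by omega)
  have h3 := Fin.natCast_ne_zero_of_lt (n := n + 4) (a := 3) (by omega) (by omega)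
  exact ⟨by exact_mod_cast h1, by exact_mod_cast h2, by exact_mod_cast h3⟩

theorem cycleGraph_boxProd_cycleGraph_adj {n m : ℕ} (a : Fin (n + 2)) (b : Fin (m + 2))
    (c : Fin (n + 2)) (d : Fin (m + 2)) :
    (cycleGraph (n + 2) □ cycleGraph (m + 2)).Adj (a, b) (c, d) ↔
      (c = a + 1 ∨ c = a - 1) ∧ d = b ∨ (d = b + 1 ∨ d = b - 1) ∧ c = a := by
  rw [boxProd_adj, cycleGraph_adj_iff_eq_add_or_eq_sub, cycleGraph_adj_iff_eq_add_or_eq_sub,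
    eq_comm (a := b), eq_comm (a := a)]

open Fin.CommRing in
theorem not_isVertexDecomposable_cycleGraph_boxProd_cycleGraph (n m : ℕ) :
    ¬ (cycleGraph (n + 4) □ cycleGraph (m + 4)).IsVertexDecomposable := by
  obtain ⟨hn1, hn2, -⟩ := Fin.one_two_three_ne_zero n
  obtain ⟨hm1, hm2, -⟩ := Fin.one_two_three_ne_zero m
  exact not_isVertexDecomposable_of_torus cycleGraph_boxProd_cycleGraph_adj hn1 hn2 hm1 hm2

open Fin.CommRing in
theorem not_isCohenMacaulay_cycleGraph_boxProd_cycleGraph (k : Type*) [Field k] (n m : ℕ) :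
    ¬ (cycleGraph (n + 4) □ cycleGraph (m + 4)).IsCohenMacaulay k := by
  obtain ⟨hn1, hn2, hn3⟩ := Fin.one_two_three_ne_zero n
  obtain ⟨hm1, hm2, hm3⟩ := Fin.one_two_three_ne_zero m
  exact not_isCohenMacaulay_of_torus k cycleGraph_boxProd_cycleGraph_adj
    hn1 hn2 hn3 hm1 hm2 hm3

end CycleGraph

end SimpleGraph

theorem mainTheorem12 (k : Type*) [Field k] (n m : ℕ) (hn : 3 ≤ n) (hm : 3 ≤ m)
    (h : (SimpleGraph.cycleGraph n □ SimpleGraph.cycleGraph m).IsVertexDecomposable ∨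
      (SimpleGraph.cycleGraph n □ SimpleGraph.cycleGraph m).IsCohenMacaulay k) :
    n = 3 ∨ m = 3 := by
  by_contra! hne
  obtain ⟨n, rfl⟩ : ∃ i, n = i + 4 := ⟨n - 4, by omega⟩
  obtain ⟨m, rfl⟩ : ∃ i, m = i + 4 := ⟨m - 4, by omega⟩
  exact h.elim (SimpleGraph.not_isVertexDecomposable_cycleGraph_boxProd_cycleGraph n m)
    (SimpleGraph.not_isCohenMacaulay_cycleGraph_boxProd_cycleGraph k n m)
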